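/- Let $S$ be a compact connected oriented surface of genus $g$, and let $\Gamma$ be a genon graph on $S$: a finite graph cellularly embedded in $S$ (its complement is a disjoint union of open discs, the faces; loops and multiple edges are allowed), in which every vertex has valence $3$ or $4$ and every face has at least two edges. Let $m$ be the number of $3$-valent vertices. We call $\Gamma$ bicolourable if its faces can be painted with two colours so that the two sides of every edge have different colours. Let $C$ be a genon code on $\Gamma$. That is, place a qubit at each of the $n$ vertices and label each corner of each face by a Pauli operator $X$, $Y$ or $Z$, such that the three corners at a $3$-valent vertex carry $X$, $Y$, $Z$ once each (in either cyclic order), and the four corners at a $4$-valent vertex carry, in cyclic order, $P,Q,P,Q$ for two different Pauli operators $P,Q$. The stabilizer of a face is the product of the Pauli operators at its corners, each acting on the qubit at the vertex of the corner, and (with phases ignored) $C\subset\mathbb F_2^n\oplus\mathbb F_2^n$ is the isotropic subspace spanned by the stabilizers of all faces. Let $k$ be the number of logical qubits that $C$ encodes, that is, $k=n-\dim C=\tfrac12\dim(C^\perp/C)$, where $C^\perp$ is the symplectic complement of $C$. Theorem. If $\Gamma$ is bicolourable, then $m=0$ and $k=2g$. If $\Gamma$ is not bicolourable, then $k=2g+\frac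 m2-1$. -/

import Mathlib

noncomputable section

/-! ### Graphs embedded in compact connected oriented surfaces -/

/-- A cell decomposition of a compact connected oriented surface by a finite embedded graph
(a combinatorial map, or rotation system). `D` is the set of darts, that is, of half-edges, each
directed away from the vertex it is attached to. The orientation of the surface enters through
`rot`, which sends a dart to the next dart counterclockwise around the same vertex. -/
structure SurfaceMap (D : Type*) where
  /-- the next dart, counterclockwise, around the same vertex -/
  rot : Equiv.Perm D
  /-- the other half of the same edge -/
  rev : Equiv.Perm D
  rev_rev : ∀ d, rev (rev d) = d
  rev_ne : ∀ d, rev d ≠ d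
  nonempty : Nonempty D
  connected : ∀ a b : D, ∃ p ∈ Subgroup.closure {rot, rev}, p a = b

namespace SurfaceMap

variable {D : Type*} (M : SurfaceMap D)

/-- Walking around the face on the left of a dart: traverse the edge, then turn to the next dart
clockwise. -/
def next : Equiv.Perm D := M.rot⁻¹ * M.rev

/-- Vertices, edges and faces are the cycles of `rot`, `rev` and `next`. -/
def Vertex : Type _ := Quotient (Equiv.Perm.SameCycle.setoid M.rot)

def Edge : Type _ := Quotient (Equiv.Perm.SameCycle.setoid M.rev)

def Face : Type _ := Quotient (Equiv.Perm.SameCycle.setoid M.next)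

/-- The vertex to which a dart is attached. -/
def vertexOf (d : D) : M.Vertex := Quotient.mk _ d

/-- The edge of which a dart is a half. -/
def edgeOf (d : D) : M.Edge := Quotient.mk _ d

/-- The face on the left of a dart. It is also the face that contains the corner
between `d` and `M.rot d` at the vertex of `d`; corners are indexed by darts in this way. -/
def faceOf (d : D) : M.Face := Quotient.mk _ d

/-- The number of edge ends at a vertex (a loop counts twice). -/
def valence (v : M.Vertex) : ℕ := Nat.card {d : D // M.vertexOf d = v}

/-- The number of edges of a face (an edge with the face on both sides counts twice). -/
def faceDegree (f : M.Face) : ℕ := Nat.card {d : D // M.faceOf d = f}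

/-- The faces can be painted in two colours such that the two sides of every edge have
different colours. -/
def Bicolourable : Prop :=
  ∃ colour : M.Face → Bool, ∀ d : D, colour (M.faceOf d) ≠ colour (M.faceOf (M.rev d))

variable [Fintype D]

instance : Finite M.Vertex := inferInstanceAs (Finite (Quotient _))
instance : Finite M.Edge := inferInstanceAs (Finite (Quotient _))
instance : Finite M.Face := inferInstanceAs (Finite (Quotient _))
instance : Fintype M.Vertex := Fintype.ofFinite _
instance : Fintype M.Edge := Fintype.ofFinite _
instance : Fintype M.Face := Fintype.ofFinite _

open Classical in
/-- The cellular boundary map from 1-chains to 0-chains, with coefficients in `ZMod 2`. -/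
def boundary₁ : (M.Edge → ZMod 2) →ₗ[ZMod 2] (M.Vertex → ZMod 2) where
  toFun x v := ∑ d with M.vertexOf d = v, x (M.edgeOf d)
  map_add' x y := by ext v; simp [Finset.sum_add_distrib]
  map_smul' a x := by ext v; simp [Finset.mul_sum]

open Classical in
/-- The cellular boundary map from 2-chains to 1-chains, with coefficients in `ZMod 2`. -/
def boundary₂ : (M.Face → ZMod 2) →ₗ[ZMod 2] (M.Edge → ZMod 2) where
  toFun c e := ∑ d with M.edgeOf d = e, c (M.faceOf d)
  map_add' x y := by ext v; simp [Finset.sum_add_distrib]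
  map_smul' a x := by ext v; simp [Finset.mul_sum]

/-- The first homology of the surface with coefficients in `ZMod 2`: cycles modulo boundaries. -/
abbrev H₁ : Type _ :=
  LinearMap.ker M.boundary₁ ⧸ (LinearMap.range M.boundary₂).submoduleOf (LinearMap.ker M.boundary₁)

/-- The genus (number of handles) of the surface: half of its first Betti number. -/
def genus : ℕ := Module.finrank (ZMod 2) M.H₁ / 2

end SurfaceMap

/-- Genon graphs: all vertices have valence three or four, and there are no monogon faces. -/
structure GenonGraph (D : Type*) extends SurfaceMap D where
  valence_eq : ∀ v : toSurfaceMap.Vertex,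
    toSurfaceMap.valence v = 3 ∨ toSurfaceMap.valence v = 4
  two_le_faceDegree : ∀ f : toSurfaceMap.Face, 2 ≤ toSurfaceMap.faceDegree f

/-- The number of 3-valent vertices. -/
def GenonGraph.numTrivalent {D : Type*} (Γ : GenonGraph D) : ℕ :=
  Nat.card {v : Γ.Vertex // Γ.valence v = 3}

/-! ### Quantum codes -/

/-- The standard symplectic space of dimension `2n`; a vector is `(X part, Z part)`. -/
abbrev SympSpace (Q : Type*) : Type _ := (Q → ZMod 2) × (Q → ZMod 2)

/-- The standard symplectic form. -/
def sympForm (Q : Type*) [Fintype Q] : LinearMap.BilinForm (ZMod 2) (SympSpace Q) :=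
  LinearMap.mk₂ (ZMod 2) (fun v w => v.1 ⬝ᵥ w.2 - v.2 ⬝ᵥ w.1)
    (fun v v' w => by simp [add_dotProduct]; ring)
    (fun a v w => by simp [smul_dotProduct]; ring)
    (fun v w w' => by simp [dotProduct_add]; ring)
    (fun a v w => by simp [dotProduct_smul]; ring)

/-- A quantum (stabilizer) code with qubits indexed by `Q`: an isotropic subspace of the
standard symplectic space. -/
structure QuantumCode (Q : Type*) [Fintype Q] where
  space : Submodule (ZMod 2) (SympSpace Q)
  isotropic : space ≤ (sympForm Q).orthogonal space

namespace QuantumCode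

variable {Q : Type*} [Fintype Q] (C : QuantumCode Q)

/-- The logical space, i.e. the symplectic complement of the code. -/
def logicalSpace : Submodule (ZMod 2) (SympSpace Q) := (sympForm Q).orthogonal C.space

/-- The number `k` of encoded logical qubits, defined by `2 k = dim (C^⊥ / C)`. -/
def numLogical : ℕ :=
  Module.finrank (ZMod 2) (C.logicalSpace ⧸ C.space.submoduleOf C.logicalSpace) / 2

end QuantumCode

/-! ### Genon codes -/

inductive Pauli
  | X
  | Y
  | Z


/-- The one-qubit vector `(X part, Z part)` of a Pauli operator. -/
def Pauli.toVec : Pauli → ZMod 2 × ZMod 2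
  | .X => (1, 0)
  | .Y => (1, 1)
  | .Z => (0, 1)

/-- Genon codes on `Γ`, with a qubit at each vertex and a stabilizer on each face. The data is the
Pauli operator `pauli d` that the face stabilizer applies at the corner between the darts `d` and
`Γ.rot d`. Around a 3-valent vertex the corners carry `X`, `Y`, `Z`, once each; around a 4-valent
vertex two different Pauli operators `P`, `Q` alternate as `P`, `Q`, `P`, `Q`. -/
structure GenonCode {D : Type*} (Γ : GenonGraph D) where
  pauli : D → Pauli
  trivalent : ∀ d, Γ.valence (Γ.vertexOf d) = 3 →
    pauli d ≠ pauli (Γ.rot d) ∧ pauli (Γ.rot d) ≠ pauli (Γ.rot (Γ.rot d)) ∧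
      pauli d ≠ pauli (Γ.rot (Γ.rot d))
  tetravalent : ∀ d, Γ.valence (Γ.vertexOf d) = 4 →
    pauli d ≠ pauli (Γ.rot d) ∧ pauli (Γ.rot (Γ.rot d)) = pauli d

namespace GenonCode

variable {D : Type*} [Fintype D] {Γ : GenonGraph D} (C : GenonCode Γ)

open Classical in
/-- The stabilizer on a face: the product, over all corners of the face, of the Pauli operator of
the corner applied to the qubit at the vertex of the corner. -/
def stabilizer (f : Γ.Face) : SympSpace Γ.Vertex :=
  (fun v => ∑ d with Γ.faceOf d = f ∧ Γ.vertexOf d = v, (C.pauli d).toVec.1,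
   fun v => ∑ d with Γ.faceOf d = f ∧ Γ.vertexOf d = v, (C.pauli d).toVec.2)

/-- The symplectic form of two one-qubit Pauli operators. -/
def om (P Q : Pauli) : ZMod 2 :=
  P.toVec.1 * Q.toVec.2 - Q.toVec.1 * P.toVec.2

lemma om_self (P : Pauli) : om P P = 0 := by simp [om]

lemma om_ne {P Q : Pauli} (h : P ≠ Q) : om P Q = 1 := by
  cases P <;> cases Q <;> first | exact absurd rfl h | decide

open Classical in
lemma sum_vertex (d : D) (h : D → ZMod 2) :
    ∑ e with Γ.vertexOf e = Γ.vertexOf d, h e * om (C.pauli d) (C.pauli e)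
      = h (Γ.rot d) + h (Γ.rot⁻¹ d) := by
  set S : Finset D := {e | Γ.vertexOf e = Γ.vertexOf d} with hS
  have hmem : ∀ e, e ∈ S ↔ Γ.rot.SameCycle e d := fun e => by
    rw [hS, Finset.mem_filter_univ]; exact Quotient.eq
  have hd : d ∈ S := (hmem d).2 (Equiv.Perm.SameCycle.refl _ _)
  have hcyc : Γ.rot.IsCycleOn (S : Set D) := by
    refine ⟨⟨fun e he => ?_, Γ.rot.injective.injOn, fun e he => ⟨Γ.rot⁻¹ e, ?_, by simp⟩⟩,
      fun x hx y hy => ((hmem x).1 hx).trans ((hmem y).1 hy).symm⟩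
    · exact (hmem _).2 (Equiv.Perm.sameCycle_apply_left.2 ((hmem e).1 he))
    · exact (hmem _).2 (Equiv.Perm.sameCycle_symm_apply_left.2 ((hmem e).1 he))
  have hsum : ∀ F : D → ZMod 2, ∑ e ∈ S, F e = ∑ i ∈ Finset.range S.card, F ((Γ.rot ^ i) d) := by
    intro F
    symm
    refine Finset.sum_bij (fun i _ => (Γ.rot ^ i) d) (fun i _ => ?_) (fun i hi j hj hij => ?_)
      (fun e he => ?_) (fun _ _ => rfl)
    · exact (hmem _).2 (Equiv.Perm.sameCycle_pow_left.2 (Equiv.Perm.SameCycle.refl _ _))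
    · exact Nat.ModEq.eq_of_lt_of_lt ((hcyc.pow_apply_eq_pow_apply hd).1 hij)
        (Finset.mem_range.1 hi) (Finset.mem_range.1 hj)
    · obtain ⟨i, hi, rfl⟩ := hcyc.exists_pow_eq hd he
      exact ⟨i, Finset.mem_range.2 hi, rfl⟩
  have hcard : Γ.valence (Γ.vertexOf d) = S.card := by
    rw [SurfaceMap.valence, Nat.card_eq_fintype_card, Fintype.card_subtype]
  have hrot : ∀ e, Γ.vertexOf (Γ.rot e) = Γ.vertexOf e := fun e =>
    Quotient.sound (s := Equiv.Perm.SameCycle.setoid Γ.rot)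
      (Equiv.Perm.sameCycle_apply_left.2 (Equiv.Perm.SameCycle.refl _ _))
  have hper := hcyc.pow_card_apply hd
  rw [hsum]
  rcases Γ.valence_eq (Γ.vertexOf d) with h3 | h4
  · obtain ⟨h1, -, h2⟩ := C.trivalent d h3
    rw [← hcard, h3] at hper ⊢
    have hinv : Γ.rot⁻¹ d = Γ.rot (Γ.rot d) := by
      rw [Equiv.Perm.inv_eq_iff_eq]; exact hper.symm
    simp [Finset.sum_range_succ, pow_succ, om_self, om_ne h1, om_ne h2, hinv]
  · obtain ⟨h1, h2⟩ := C.tetravalent d h4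
    obtain ⟨-, h3⟩ := C.tetravalent (Γ.rot d) (by rw [hrot, h4])
    rw [← h3] at h1
    rw [← hcard, h4] at hper ⊢
    have hinv : Γ.rot⁻¹ d = Γ.rot (Γ.rot (Γ.rot d)) := by
      rw [Equiv.Perm.inv_eq_iff_eq]; exact hper.symm
    simp [Finset.sum_range_succ, pow_succ, om_self, om_ne h1, om_ne (h3 ▸ h1), h2, hinv]

open Classical in
lemma sympForm_stabilizer (f f' : Γ.Face) :
    sympForm Γ.Vertex (C.stabilizer f) (C.stabilizer f') = 0 := by
  have key : sympForm Γ.Vertex (C.stabilizer f) (C.stabilizer f') =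
      ∑ d, (if Γ.faceOf d = f then 1 else 0) *
        ∑ e with Γ.vertexOf e = Γ.vertexOf d,
          (if Γ.faceOf e = f' then 1 else 0) * om (C.pauli d) (C.pauli e) := by
    have aux : ∀ (g g' : Γ.Face) (x z : D → ZMod 2),
        ∑ v, (∑ d with Γ.faceOf d = g ∧ Γ.vertexOf d = v, x d) *
          (∑ e with Γ.faceOf e = g' ∧ Γ.vertexOf e = v, z e) =
        ∑ d, ∑ e, if Γ.faceOf d = g ∧ Γ.faceOf e = g' ∧ Γ.vertexOf e = Γ.vertexOf d
          then x d * z e else 0 := by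
      intro g g' x z
      simp only [Finset.sum_filter, Finset.sum_mul_sum]
      rw [Finset.sum_comm]
      refine Finset.sum_congr rfl fun d _ => ?_
      rw [Finset.sum_comm]
      refine Finset.sum_congr rfl fun e _ => ?_
      rw [Finset.sum_eq_single (Γ.vertexOf d)]
      · split_ifs <;> simp_all
      · intro v _ hv
        rw [if_neg (fun h => hv h.2.symm), zero_mul]
      · simp
    simp only [sympForm, LinearMap.mk₂_apply, stabilizer, dotProduct]
    rw [aux, aux, ← Finset.sum_sub_distrib]
    refine Finset.sum_congr rfl fun d _ => ?_
    rw [← Finset.sum_sub_distrib, Finset.sum_filter, Finset.mul_sum]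
    refine Finset.sum_congr rfl fun e _ => ?_
    by_cases h1 : Γ.faceOf d = f <;> by_cases h2 : Γ.faceOf e = f' <;>
      by_cases h3 : Γ.vertexOf e = Γ.vertexOf d <;> simp [h1, h2, h3, om, mul_comm]
  have hface : ∀ d, Γ.faceOf (Γ.rot⁻¹ d) = Γ.faceOf (Γ.rev d) := fun d => by
    refine Quotient.sound (s := Equiv.Perm.SameCycle.setoid Γ.next) ⟨-1, ?_⟩
    rw [zpow_neg_one, Equiv.Perm.inv_eq_iff_eq]
    simp [SurfaceMap.next, Γ.rev_rev]
  simp only [key, C.sum_vertex, mul_add, Finset.sum_add_distrib, hface]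
  have h1 : ∑ d, (if Γ.faceOf d = f then (1 : ZMod 2) else 0) *
        (if Γ.faceOf (Γ.rot d) = f' then 1 else 0) =
      ∑ d, (if Γ.faceOf (Γ.rev d) = f then (1 : ZMod 2) else 0) *
        (if Γ.faceOf d = f' then 1 else 0) := by
    rw [← Equiv.sum_comp Γ.rot⁻¹]
    simp [← hface]
  have h2 : ∑ d, (if Γ.faceOf (Γ.rev d) = f then (1 : ZMod 2) else 0) *
        (if Γ.faceOf d = f' then 1 else 0) =
      ∑ d, (if Γ.faceOf d = f then (1 : ZMod 2) else 0) *
        (if Γ.faceOf (Γ.rev d) = f' then 1 else 0) := by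
    rw [← Equiv.sum_comp Γ.rev]
    simp [Γ.rev_rev]
  rw [h1, h2]
  exact CharTwo.add_self_eq_zero _

/-- The quantum code spanned by the face stabilizers. -/
def toQuantumCode : QuantumCode Γ.Vertex where
  space := Submodule.span (ZMod 2) (Set.range C.stabilizer)
  isotropic := by
    rw [Submodule.span_le]
    rintro _ ⟨f, rfl⟩
    rw [SetLike.mem_coe, LinearMap.BilinForm.mem_orthogonal_iff]
    intro w hw
    induction hw using Submodule.span_induction with
    | mem x hx => obtain ⟨f', rfl⟩ := hx; exact C.sympForm_stabilizer f' f
    | zero => simp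
    | add x y _ _ hx hy =>
      simp only [map_add, LinearMap.add_apply] at *
      rw [hx, hy, add_zero]
    | smul a x _ hx =>
      simp only [map_smul, LinearMap.smul_apply] at *
      rw [hx, smul_zero]

end GenonCode

end

/-!
Write `V`, `E`, `F` for the numbers of vertices, edges and faces. Every relation
`∑ c f • stabilizer f = 0` is tested by commuting the left side with the Pauli operators of single
corners. At the corner of a dart `d`, by `GenonCode.sum_vertex`, the test says that `c` agrees on
the two corners adjacent to it (`GenonCode.mem_relations_iff`). Equivalently, the
difference of `c` across an edge is the same for consecutive edges at every vertex, hence, the graph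
being connected, for all edges. Difference `0` means that `c` is constant, and difference `1` that
`c` is a bicolouring. So the relations have dimension `2` if the graph is bicolourable and `1`
otherwise, and `k = V - F + 2` or `k = V - F + 1` accordingly.

On the topological side `2 g = 2 - V + E - F` (`SurfaceMap.two_mul_genus_add`). The dimension of
`H₁` is computed from the ranks of the boundary maps, where connectedness makes the kernels of
`boundary₂` and of the transpose of `boundary₁` one-dimensional. Since the genus is defined as half
of that dimension, rounded down, the dimension must also be shown to be even. This is where
orientability enters: the sign of a permutation of the darts is determined by its number of cycles,
and `next = rot⁻¹ * rev` makes `V + E + F` even.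

Counting darts gives `2 E = 4 V - m`, which turns one formula into the other. In the bicolourable
case the colours alternate around each vertex, so all valences are even and `m = 0`.
-/

open Module Finset

/-! ### Cycles of a permutation and its sign -/

open Classical in
/-- The sign of a permutation is the parity of the number of points plus the number of cycles,
where fixed points count as cycles. -/
lemma sign_eq_neg_one_pow_card_add_card_quotient {α : Type*} [Fintype α] (σ : Equiv.Perm α) :
    (Equiv.Perm.sign σ : ℤ) =
      (-1) ^ (Fintype.card α + Nat.card (Quotient (Equiv.Perm.SameCycle.setoid σ))) := by
  -- The nontrivial cycles are the elements of `cycleFactorsFinset`, the others the fixed points.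
  let G : α → Equiv.Perm α ⊕ α := fun d => if σ d = d then .inr d else .inl (σ.cycleOf d)
  have hG : ∀ a b, σ.SameCycle a b ↔ G a = G b := by
    intro a b
    by_cases ha : σ a = a <;> by_cases hb : σ b = b
    · simp only [G, ha, hb, if_true, Sum.inr.injEq]
      exact ⟨fun h => h.eq_of_left ha, fun h => h ▸ .refl _ _⟩
    · simp only [G, ha, hb, if_true, if_false, reduceCtorEq, iff_false]
      exact fun h => hb (h.apply_eq_self_iff.1 ha)
    · simp only [G, ha, hb, if_true, if_false, reduceCtorEq, iff_false]
      exact fun h => ha (h.apply_eq_self_iff.2 hb)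
    · simp only [G, ha, hb, if_false, Sum.inl.injEq]
      exact Equiv.Perm.sameCycle_iff_cycleOf_eq_of_mem_support
        (Equiv.Perm.mem_support.2 ha) (Equiv.Perm.mem_support.2 hb)
  let F : Quotient (Equiv.Perm.SameCycle.setoid σ) → Equiv.Perm α ⊕ α :=
    Quotient.lift G fun a b h => (hG a b).1 h
  have hF : Function.Injective F := by
    intro x y
    induction x, y using Quotient.inductionOn₂ with
    | h a b => exact fun h => Quotient.sound ((hG a b).2 h)
  have himage : univ.image F = σ.cycleFactorsFinset.disjSum σ.supportᶜ := by
    ext x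
    constructor
    · simp only [mem_image, mem_univ, true_and]
      rintro ⟨q, rfl⟩
      induction q using Quotient.inductionOn with
      | h a =>
        change G a ∈ _
        by_cases ha : σ a = a
        · simp [G, ha]
        · simp [G, ha, Equiv.Perm.cycleOf_mem_cycleFactorsFinset_iff]
    · intro hx
      rcases x with c | d
      · rw [inl_mem_disjSum] at hx
        obtain ⟨a, ha⟩ := (Equiv.Perm.mem_cycleFactorsFinset_iff.1 hx).1.nonempty_support
        have hc := Equiv.Perm.cycle_is_cycleOf ha hx
        have ha' : σ a ≠ a :=
          Equiv.Perm.mem_support.1 (Equiv.Perm.mem_cycleFactorsFinset_support_le hx ha)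
        refine mem_image.2 ⟨Quotient.mk _ a, mem_univ _, ?_⟩
        change G a = _
        simp [G, ha', hc]
      · rw [inr_mem_disjSum, mem_compl, Equiv.Perm.notMem_support] at hx
        refine mem_image.2 ⟨Quotient.mk _ d, mem_univ _, ?_⟩
        change G d = _
        simp [G, hx]
  have hcard : Nat.card (Quotient (Equiv.Perm.SameCycle.setoid σ)) =
      σ.cycleFactorsFinset.card + σ.supportᶜ.card := by
    rw [← card_disjSum, ← himage, card_image_of_injective _ hF, card_univ,
      Nat.card_eq_fintype_card]
  have htype : σ.cycleType.card = σ.cycleFactorsFinset.card := by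
    simp [Equiv.Perm.cycleType_def]
  have hcompl := card_add_card_compl σ.support
  rw [Equiv.Perm.sign_of_cycleType, Equiv.Perm.sum_cycleType, htype, hcard, ← hcompl]
  push_cast
  rw [show #σ.support + #σ.supportᶜ + (#σ.cycleFactorsFinset + #σ.supportᶜ) =
    (#σ.support + #σ.cycleFactorsFinset) + 2 * #σ.supportᶜ by ring, pow_add _ _ (2 * _)]
  simp [pow_mul]

/-! ### Linear algebra over the field with two elements -/

/-- A space of functions that consists of the constant functions is one-dimensional. -/
lemma finrank_eq_one_of_mem_iff_constant {K A : Type*} [Field K] [Nonempty A]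
    (W : Submodule K (A → K)) (hW : ∀ x, x ∈ W ↔ ∀ a b, x a = x b) : finrank K W = 1 := by
  have h : W = K ∙ (1 : A → K) := by
    ext x
    rw [hW, Submodule.mem_span_singleton]
    constructor
    · intro hx
      exact ⟨x (Classical.arbitrary A), by ext a; simp [hx a (Classical.arbitrary A)]⟩
    · rintro ⟨c, rfl⟩ a b
      rfl
  rw [h, finrank_span_singleton one_ne_zero]

open Classical in
/-- Pull a function back along `p` and push it forward along `q` by summing over fibres. -/
noncomputable def pullPush {D A B : Type*} [Fintype D] (K : Type*) [Field K]
    (p : D → A) (q : D → B) : (A → K) →ₗ[K] (B → K) where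
  toFun x b := ∑ d with q d = b, x (p d)
  map_add' x y := by ext v; simp [sum_add_distrib]
  map_smul' a x := by ext v; simp [mul_sum]

/-- Exchanging the two legs transposes the matrix, so it preserves the rank. -/
lemma finrank_range_pullPush_comm {D A B : Type*} [Fintype D] [Fintype A] [Fintype B]
    (K : Type*) [Field K] (p : D → A) (q : D → B) :
    finrank K (LinearMap.range (pullPush K p q)) =
      finrank K (LinearMap.range (pullPush K q p)) := by
  classical
  let N : Matrix A B K := .of fun a b => ∑ d, if q d = b ∧ p d = a then 1 else 0
  have h1 : pullPush K q p = N.mulVecLin := by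
    refine LinearMap.ext fun x => funext fun a => ?_
    simp only [pullPush, N, Matrix.mulVecLin_apply, Matrix.mulVec, Matrix.of_apply, dotProduct,
      sum_mul, LinearMap.coe_mk, AddHom.coe_mk, sum_filter]
    rw [sum_comm]
    exact sum_congr rfl fun d _ => by simp [ite_and]
  have h2 : pullPush K p q = N.transpose.mulVecLin := by
    refine LinearMap.ext fun x => funext fun b => ?_
    simp only [pullPush, N, Matrix.mulVecLin_apply, Matrix.mulVec, Matrix.of_apply, dotProduct,
      sum_mul, LinearMap.coe_mk, AddHom.coe_mk, sum_filter, Matrix.transpose_apply]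
    rw [sum_comm]
    exact sum_congr rfl fun d _ => by simp [and_comm (a := q d = b), ite_and]
  rw [h1, h2]
  exact N.rank_transpose

/-- Passing to the quotient by a subspace drops the dimension by that of the subspace. -/
lemma finrank_quotient_submoduleOf_add {K V : Type*} [Field K] [AddCommGroup V] [Module K V]
    [FiniteDimensional K V] {p q : Submodule K V} (h : p ≤ q) :
    finrank K (q ⧸ p.submoduleOf q) + finrank K p = finrank K q := by
  rw [← (Submodule.submoduleOfEquivOfLe h).finrank_eq]
  exact Submodule.finrank_quotient_add_finrank _

lemma sympForm_nondegenerate (Q : Type*) [Fintype Q] : (sympForm Q).Nondegenerate := by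
  classical
  have hrefl : (sympForm Q).IsRefl := by
    intro v w h
    simp only [sympForm, LinearMap.mk₂_apply] at h ⊢
    rw [dotProduct_comm w.1, dotProduct_comm w.2, ← neg_sub, h, neg_zero]
  refine hrefl.nondegenerate_iff_separatingLeft.2 fun v hv => ?_
  ext q
  · simpa [sympForm] using hv (0, Pi.single q 1)
  · simpa [sympForm] using hv (Pi.single q 1, 0)

/-- An isotropic subspace of dimension `r` leaves a logical space of dimension `2n - 2r`. -/
lemma QuantumCode.finrank_logicalSpace_quotient_add {Q : Type*} [Fintype Q] (C : QuantumCode Q) :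
    finrank (ZMod 2) (C.logicalSpace ⧸ C.space.submoduleOf C.logicalSpace) +
      2 * finrank (ZMod 2) C.space = 2 * Fintype.card Q := by
  have h1 := finrank_quotient_submoduleOf_add (q := C.logicalSpace) C.isotropic
  have h2 : finrank (ZMod 2) C.logicalSpace = _ :=
    LinearMap.BilinForm.finrank_orthogonal (sympForm_nondegenerate Q) C.space
  have h3 : finrank (ZMod 2) (SympSpace Q) = 2 * Fintype.card Q := by
    simp [Module.finrank_prod, two_mul]
  have h4 := Submodule.finrank_le C.space
  omega

/-! ### The Euler characteristic of a cell decomposition -/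

namespace SurfaceMap

variable {D : Type*} (M : SurfaceMap D)

lemma vertexOf_rot (d : D) : M.vertexOf (M.rot d) = M.vertexOf d :=
  Quotient.sound (s := Equiv.Perm.SameCycle.setoid M.rot)
    (Equiv.Perm.sameCycle_apply_left.2 (Equiv.Perm.SameCycle.refl _ _))

lemma edgeOf_rev (d : D) : M.edgeOf (M.rev d) = M.edgeOf d :=
  Quotient.sound (s := Equiv.Perm.SameCycle.setoid M.rev)
    (Equiv.Perm.sameCycle_apply_left.2 (Equiv.Perm.SameCycle.refl _ _))

/-- The corner clockwise of a dart lies in the face on the other side of its edge. -/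
lemma faceOf_rot_inv (d : D) : M.faceOf (M.rot⁻¹ d) = M.faceOf (M.rev d) := by
  refine Quotient.sound (s := Equiv.Perm.SameCycle.setoid M.next) ⟨-1, ?_⟩
  rw [zpow_neg_one, Equiv.Perm.inv_eq_iff_eq]
  simp [next, M.rev_rev]

lemma faceOf_rev_rot (d : D) : M.faceOf (M.rev (M.rot d)) = M.faceOf d := by
  rw [← faceOf_rot_inv, Equiv.Perm.inv_def, Equiv.symm_apply_apply]

lemma vertexOf_surjective : Function.Surjective M.vertexOf := Quotient.mk_surjective

lemma edgeOf_surjective : Function.Surjective M.edgeOf := Quotient.mk_surjective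

lemma faceOf_surjective : Function.Surjective M.faceOf := Quotient.mk_surjective

/-- Connectedness: a function on darts is constant if it is invariant under both generators. -/
lemma eq_of_invariant {β : Type*} {h : D → β} (hrot : ∀ d, h (M.rot d) = h d)
    (hrev : ∀ d, h (M.rev d) = h d) (a b : D) : h a = h b := by
  obtain ⟨p, hp, rfl⟩ := M.connected a b
  suffices ∀ d, h (p d) = h d from (this a).symm
  induction hp using Subgroup.closure_induction with
  | mem x hx =>
    rcases hx with rfl | rfl
    exacts [hrot, hrev]
  | one => simp
  | mul x y _ _ hx hy => intro d; rw [Equiv.Perm.mul_apply, hx, hy]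
  | inv x _ hx => intro d; rw [← hx, Equiv.Perm.inv_def, Equiv.apply_symm_apply]

lemma edgeOf_eq_iff {d e : D} : M.edgeOf e = M.edgeOf d ↔ e = d ∨ e = M.rev d := by
  constructor
  · intro h
    obtain ⟨i, hi⟩ := (Quotient.exact h : M.rev.SameCycle e d).symm
    have hsq : M.rev ^ (2 : ℤ) = 1 := by
      ext x
      exact M.rev_rev x
    rcases Int.even_or_odd' i with ⟨j, rfl | rfl⟩
    · left; simpa [zpow_mul, hsq] using hi.symm
    · right; simpa [zpow_add, zpow_mul, hsq] using hi.symm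
  · rintro (rfl | rfl)
    · rfl
    · exact M.edgeOf_rev _

lemma eq_of_faceOf_rev_eq {β : Type*} {c : M.Face → β}
    (hc : ∀ d, c (M.faceOf (M.rev d)) = c (M.faceOf d)) (f f' : M.Face) : c f = c f' := by
  revert f f'
  rw [M.faceOf_surjective.forall₂]
  refine M.eq_of_invariant (h := fun d => c (M.faceOf d)) (fun d => ?_) hc
  rw [← hc, M.faceOf_rev_rot]

/-- A bicolouring with values in `ZMod 2` has coboundary `1` on every edge. -/
lemma bicolourable_iff :
    M.Bicolourable ↔ ∃ c : M.Face → ZMod 2, ∀ d, c (M.faceOf d) + c (M.faceOf (M.rev d)) = 1 := by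
  constructor
  · rintro ⟨χ, hχ⟩
    refine ⟨fun f => if χ f then 1 else 0, fun d => ?_⟩
    have := hχ d
    cases h1 : χ (M.faceOf d) <;> cases h2 : χ (M.faceOf (M.rev d)) <;> simp_all
  · rintro ⟨c, hc⟩
    refine ⟨fun f => decide (c f = 1), fun d h => ?_⟩
    have hd := hc d
    change decide (c (M.faceOf d) = 1) = decide (c (M.faceOf (M.rev d)) = 1) at h
    revert h hd
    generalize c (M.faceOf d) = x at *
    generalize c (M.faceOf (M.rev d)) = y at *
    decide +revert

variable [Fintype D]

instance : Nonempty M.Vertex := M.nonempty.map M.vertexOf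

instance : Nonempty M.Face := M.nonempty.map M.faceOf

open Classical in
lemma sum_edge {K : Type*} [AddCommMonoid K] (d : D) (h : D → K) :
    ∑ e with M.edgeOf e = M.edgeOf d, h e = h d + h (M.rev d) := by
  have : (univ.filter fun e => M.edgeOf e = M.edgeOf d) = {d, M.rev d} := by
    ext e
    simp [edgeOf_eq_iff]
  rw [this, sum_pair (M.rev_ne d).symm]

open Classical in
lemma sum_vertex_rot_inv {K : Type*} [AddCommMonoid K] (v : M.Vertex) (h : D → K) :
    ∑ d with M.vertexOf d = v, h (M.rot⁻¹ d) = ∑ d with M.vertexOf d = v, h d := by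
  simp only [sum_filter]
  rw [← Equiv.sum_comp M.rot]
  simp [vertexOf_rot]

lemma two_mul_card_edge : 2 * Fintype.card M.Edge = Fintype.card D := by
  classical
  rw [← card_univ (α := D), card_eq_sum_card_fiberwise (f := M.edgeOf) (t := univ)
    (fun _ _ => mem_univ _), mul_comm, ← smul_eq_mul, ← card_univ, ← sum_const]
  refine sum_congr rfl fun e _ => ?_
  obtain ⟨d, rfl⟩ := M.edgeOf_surjective e
  rw [card_eq_sum_ones, M.sum_edge d (fun _ => 1)]

lemma sum_valence : ∑ v, M.valence v = Fintype.card D := by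
  classical
  rw [← card_univ (α := D), card_eq_sum_card_fiberwise (f := M.vertexOf) (t := univ)
    (fun _ _ => mem_univ _)]
  refine sum_congr rfl fun v _ => ?_
  rw [valence, Nat.card_eq_fintype_card, Fintype.card_subtype]

/-- The Euler characteristic is even because `next = rot⁻¹ * rev` and sign is multiplicative. -/
lemma even_card_vertex_add_card_edge_add_card_face :
    Even (Fintype.card M.Vertex + Fintype.card M.Edge + Fintype.card M.Face) := by
  classical
  have h1 : (Equiv.Perm.sign M.rot : ℤ) = (-1) ^ (Fintype.card D + Fintype.card M.Vertex) :=
    Nat.card_eq_fintype_card (α := M.Vertex) ▸ sign_eq_neg_one_pow_card_add_card_quotient M.rot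
  have h2 : (Equiv.Perm.sign M.rev : ℤ) = (-1) ^ (Fintype.card D + Fintype.card M.Edge) :=
    Nat.card_eq_fintype_card (α := M.Edge) ▸ sign_eq_neg_one_pow_card_add_card_quotient M.rev
  have h3 : (Equiv.Perm.sign M.next : ℤ) = (-1) ^ (Fintype.card D + Fintype.card M.Face) :=
    Nat.card_eq_fintype_card (α := M.Face) ▸ sign_eq_neg_one_pow_card_add_card_quotient M.next
  have h4 : (Equiv.Perm.sign M.next : ℤ) = Equiv.Perm.sign M.rot * Equiv.Perm.sign M.rev := by
    simp [next]
  have h5 := M.two_mul_card_edge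
  rw [h1, h2, h3, ← pow_add] at h4
  have h6 := congrArg (· * (-1 : ℤ) ^ (Fintype.card D + Fintype.card M.Face)) h4
  simp only [← pow_add] at h6
  rw [Even.neg_one_pow ⟨_, rfl⟩] at h6
  have h7 := (neg_one_pow_eq_one_iff_even (by norm_num)).1 h6.symm
  rw [← h5] at h7
  rw [Nat.even_iff] at h7 ⊢
  omega

lemma boundary₁_eq_pullPush : M.boundary₁ = pullPush (ZMod 2) M.edgeOf M.vertexOf := rfl

lemma boundary₂_eq_pullPush : M.boundary₂ = pullPush (ZMod 2) M.faceOf M.edgeOf := rfl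

lemma range_boundary₂_le_ker_boundary₁ :
    LinearMap.range M.boundary₂ ≤ LinearMap.ker M.boundary₁ := by
  classical
  rintro _ ⟨c, rfl⟩
  rw [LinearMap.mem_ker]
  ext v
  simp only [boundary₁, boundary₂, LinearMap.coe_mk, AddHom.coe_mk, Pi.zero_apply]
  simp_rw [M.sum_edge _ (fun d => c (M.faceOf d)), sum_add_distrib, ← faceOf_rot_inv]
  rw [M.sum_vertex_rot_inv v (fun d => c (M.faceOf d))]
  exact CharTwo.add_self_eq_zero _

lemma mem_ker_pullPush_edgeOf {A : Type*} (p : D → A) (x : A → ZMod 2) :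
    x ∈ LinearMap.ker (pullPush (ZMod 2) p M.edgeOf) ↔ ∀ d, x (p (M.rev d)) = x (p d) := by
  classical
  rw [LinearMap.mem_ker, funext_iff, M.edgeOf_surjective.forall]
  refine forall_congr' fun d => ?_
  rw [eq_comm (a := x (p (M.rev d))), ← CharTwo.add_eq_zero (R := ZMod 2) (a := x (p d)),
    ← M.sum_edge d (fun e => x (p e))]
  rfl

/-- The first homology has dimension `2 - χ`. Both the boundary map from faces and the transpose of
the boundary map from edges have only the constants in their kernel. -/
lemma finrank_H₁_add :
    finrank (ZMod 2) M.H₁ + Fintype.card M.Vertex + Fintype.card M.Face =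
      Fintype.card M.Edge + 2 := by
  have hF : finrank (ZMod 2) (LinearMap.ker M.boundary₂) = 1 := by
    refine finrank_eq_one_of_mem_iff_constant _ fun c => ?_
    rw [boundary₂_eq_pullPush, mem_ker_pullPush_edgeOf]
    exact ⟨M.eq_of_faceOf_rev_eq, fun h d => h _ _⟩
  have hV : finrank (ZMod 2) (LinearMap.ker (pullPush (ZMod 2) M.vertexOf M.edgeOf)) = 1 := by
    refine finrank_eq_one_of_mem_iff_constant _ fun c => ?_
    rw [mem_ker_pullPush_edgeOf, M.vertexOf_surjective.forall₂]
    exact ⟨fun h => M.eq_of_invariant (h := fun d => c (M.vertexOf d))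
      (fun d => by rw [vertexOf_rot]) h, fun h d => h _ _⟩
  have h1 := finrank_quotient_submoduleOf_add M.range_boundary₂_le_ker_boundary₁
  have h2 := M.boundary₁.finrank_range_add_finrank_ker
  have h3 := M.boundary₂.finrank_range_add_finrank_ker
  have h4 := (pullPush (ZMod 2) M.vertexOf M.edgeOf).finrank_range_add_finrank_ker
  rw [boundary₁_eq_pullPush, finrank_range_pullPush_comm, ← boundary₁_eq_pullPush] at h2
  rw [finrank_fintype_fun_eq_card] at h2 h3 h4
  change finrank (ZMod 2) M.H₁ + _ = _ at h1
  omega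

lemma two_mul_genus_add :
    2 * M.genus + Fintype.card M.Vertex + Fintype.card M.Face = Fintype.card M.Edge + 2 := by
  have h1 := M.finrank_H₁_add
  have h2 := M.even_card_vertex_add_card_edge_add_card_face
  rw [Nat.even_iff] at h2
  rw [genus]
  omega

end SurfaceMap

lemma GenonGraph.card_add_numTrivalent {D : Type*} [Fintype D] (Γ : GenonGraph D) :
    Fintype.card D + Γ.numTrivalent = 4 * Fintype.card Γ.Vertex := by
  classical
  rw [← Γ.sum_valence, numTrivalent, Nat.card_eq_fintype_card, Fintype.card_subtype,
    card_filter, ← sum_add_distrib, mul_comm, ← smul_eq_mul, ← card_univ, ← sum_const]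
  refine sum_congr rfl fun v _ => ?_
  rcases Γ.valence_eq v with h | h <;> simp [h]

/-! ### Relations between the face stabilizers -/

namespace GenonCode

variable {D : Type*} {Γ : GenonGraph D} (C : GenonCode Γ)

lemma pauli_ne_pauli_rot (d : D) : C.pauli d ≠ C.pauli (Γ.rot d) := by
  rcases Γ.valence_eq (Γ.vertexOf d) with h | h
  exacts [(C.trivalent d h).1, (C.tetravalent d h).1]

/-- A one-qubit vector that commutes with two different Pauli operators vanishes. -/
lemma eq_zero_of_commutes {P Q : Pauli} (h : P ≠ Q) {a b : ZMod 2}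
    (hP : P.toVec.1 * b - a * P.toVec.2 = 0) (hQ : Q.toVec.1 * b - a * Q.toVec.2 = 0) :
    a = 0 ∧ b = 0 := by
  cases P <;> cases Q <;> simp_all [Pauli.toVec]

variable [Fintype D]

/-- The coefficient families of the linear relations between the face stabilizers. -/
noncomputable def relations : Submodule (ZMod 2) (Γ.Face → ZMod 2) :=
  LinearMap.ker (Fintype.linearCombination (ZMod 2) C.stabilizer)

open Classical in
lemma sum_smul_stabilizer (c : Γ.Face → ZMod 2) :
    ∑ f, c f • C.stabilizer f =
      (fun v => ∑ d with Γ.vertexOf d = v, c (Γ.faceOf d) * (C.pauli d).toVec.1,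
       fun v => ∑ d with Γ.vertexOf d = v, c (Γ.faceOf d) * (C.pauli d).toVec.2) := by
  have aux : ∀ (v : Γ.Vertex) (x : D → ZMod 2),
      ∑ f, c f * ∑ d with Γ.faceOf d = f ∧ Γ.vertexOf d = v, x d =
        ∑ d with Γ.vertexOf d = v, c (Γ.faceOf d) * x d := by
    intro v x
    simp only [sum_filter, mul_sum]
    rw [sum_comm]
    refine sum_congr rfl fun d _ => ?_
    rw [sum_eq_single (Γ.faceOf d) (fun f _ hf => by simp [hf.symm]) (by simp)]
    simp
  ext v
  · simp [stabilizer, Prod.fst_sum, aux]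
  · simp [stabilizer, Prod.snd_sum, aux]

/-- A combination of stabilizers is trivial exactly when it commutes with the Pauli operator of
every corner, and by `sum_vertex` this compares the two neighbouring corners. -/
lemma mem_relations_iff (c : Γ.Face → ZMod 2) :
    c ∈ C.relations ↔ ∀ d, c (Γ.faceOf (Γ.rot d)) = c (Γ.faceOf (Γ.rev d)) := by
  classical
  have key : ∀ d, (C.pauli d).toVec.1 *
        (∑ e with Γ.vertexOf e = Γ.vertexOf d, c (Γ.faceOf e) * (C.pauli e).toVec.2) -
      (∑ e with Γ.vertexOf e = Γ.vertexOf d, c (Γ.faceOf e) * (C.pauli e).toVec.1) *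
        (C.pauli d).toVec.2 = c (Γ.faceOf (Γ.rot d)) + c (Γ.faceOf (Γ.rev d)) := by
    intro d
    rw [← Γ.faceOf_rot_inv, ← C.sum_vertex d (fun e => c (Γ.faceOf e)), mul_sum, sum_mul,
      ← sum_sub_distrib]
    refine sum_congr rfl fun e _ => ?_
    rw [om]
    ring
  rw [relations, LinearMap.mem_ker, Fintype.linearCombination_apply, sum_smul_stabilizer,
    Prod.ext_iff, funext_iff, funext_iff]
  constructor
  · rintro ⟨hX, hZ⟩ d
    rw [← CharTwo.add_eq_zero, ← key d]
    have hX := hX (Γ.vertexOf d)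
    have hZ := hZ (Γ.vertexOf d)
    simp only [Prod.fst_zero, Prod.snd_zero, Pi.zero_apply] at hX hZ
    rw [hX, hZ]
    ring
  · intro h
    rw [← forall_and, Γ.vertexOf_surjective.forall]
    intro d
    have h1 := key d
    have h2 := key (Γ.rot d)
    rw [CharTwo.add_eq_zero.2 (h _)] at h1 h2
    rw [Γ.vertexOf_rot] at h2
    exact eq_zero_of_commutes (C.pauli_ne_pauli_rot d) h1 h2

/-- For a relation, the difference of the coefficients on the two sides of an edge is the same for
all edges. -/
lemma add_rev_eq_of_mem_relations {c : Γ.Face → ZMod 2} (hc : c ∈ C.relations) (a b : D) :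
    c (Γ.faceOf a) + c (Γ.faceOf (Γ.rev a)) = c (Γ.faceOf b) + c (Γ.faceOf (Γ.rev b)) := by
  rw [mem_relations_iff] at hc
  refine Γ.eq_of_invariant (h := fun d => c (Γ.faceOf d) + c (Γ.faceOf (Γ.rev d)))
    (fun d => ?_) (fun d => ?_) a b
  · rw [Γ.faceOf_rev_rot, hc, add_comm]
  · rw [Γ.rev_rev, add_comm]

lemma finrank_relations_of_not_bicolourable (h : ¬ Γ.Bicolourable) :
    finrank (ZMod 2) C.relations = 1 := by
  refine finrank_eq_one_of_mem_iff_constant _ fun c => ⟨fun hc => ?_, fun hc => ?_⟩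
  · refine Γ.eq_of_faceOf_rev_eq fun d => ?_
    by_contra hd
    refine h (Γ.bicolourable_iff.2 ⟨c, fun e => ?_⟩)
    rw [C.add_rev_eq_of_mem_relations hc e d]
    revert hd
    generalize c (Γ.faceOf d) = x at *
    generalize c (Γ.faceOf (Γ.rev d)) = y at *
    decide +revert
  · exact (C.mem_relations_iff c).2 fun d => hc _ _

lemma finrank_relations_of_bicolourable (h : Γ.Bicolourable) :
    finrank (ZMod 2) C.relations = 2 := by
  obtain ⟨χ, hχ⟩ := Γ.bicolourable_iff.1 h
  obtain ⟨d₀⟩ := Γ.nonempty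
  have hspan : C.relations = Submodule.span (ZMod 2) (Set.range ![1, χ]) := by
    ext c
    rw [Matrix.range_cons, Matrix.range_cons, Matrix.range_empty, Set.union_empty,
      Set.singleton_union, Submodule.mem_span_pair]
    constructor
    · intro hc
      -- The coefficient of `χ` is the common jump `t` of `c` across the edges.
      let t := c (Γ.faceOf d₀) + c (Γ.faceOf (Γ.rev d₀))
      have hconst : ∀ f f', c f + t * χ f = c f' + t * χ f' := by
        refine Γ.eq_of_faceOf_rev_eq (c := fun f => c f + t * χ f) fun d => ?_
        have h1 : _ = t := C.add_rev_eq_of_mem_relations hc d d₀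
        have h2 := hχ d
        rw [← CharTwo.add_eq_zero]
        linear_combination h1 + t * h2 + CharTwo.add_self_eq_zero t
      refine ⟨c (Γ.faceOf d₀) + t * χ (Γ.faceOf d₀), t, ?_⟩
      ext f
      simp only [Pi.add_apply, Pi.smul_apply, Pi.one_apply, smul_eq_mul, mul_one]
      rw [← hconst f]
      linear_combination CharTwo.add_self_eq_zero (t * χ f)
    · rintro ⟨s, t, rfl⟩
      rw [mem_relations_iff]
      intro d
      have h1 := hχ d
      have h2 := hχ (Γ.rot d)
      rw [Γ.faceOf_rev_rot] at h2
      simp only [Pi.add_apply, Pi.smul_apply, Pi.one_apply, smul_eq_mul]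
      linear_combination t * (h2 - h1)
  have hind : LinearIndependent (ZMod 2) ![1, χ] := by
    refine LinearIndependent.pair_iff.2 fun s t hst => ?_
    have h1 := congrFun hst (Γ.faceOf d₀)
    have h2 := congrFun hst (Γ.faceOf (Γ.rev d₀))
    simp only [Pi.add_apply, Pi.smul_apply, Pi.one_apply, smul_eq_mul, mul_one,
      Pi.zero_apply] at h1 h2
    have ht : t = 0 := by
      linear_combination h1 + h2 - t * hχ d₀ - CharTwo.add_self_eq_zero s
    exact ⟨by simpa [ht] using h1, ht⟩
  rw [hspan, finrank_span_eq_card hind, Fintype.card_fin]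

/-- In a bicolourable graph the colours alternate around each vertex, so valences are even. -/
lemma numTrivalent_eq_zero_of_bicolourable (h : Γ.Bicolourable) : Γ.numTrivalent = 0 := by
  classical
  obtain ⟨χ, hχ⟩ := Γ.bicolourable_iff.1 h
  rw [GenonGraph.numTrivalent, Nat.card_eq_zero]
  refine .inl ⟨fun ⟨v, hv⟩ => ?_⟩
  have h1 : ∑ d with Γ.vertexOf d = v, (χ (Γ.faceOf d) + χ (Γ.faceOf (Γ.rev d))) = 0 := by
    simp_rw [← Γ.faceOf_rot_inv, sum_add_distrib]
    rw [Γ.sum_vertex_rot_inv v (fun d => χ (Γ.faceOf d))]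
    exact CharTwo.add_self_eq_zero _
  rw [SurfaceMap.valence, Nat.card_eq_fintype_card, Fintype.card_subtype] at hv
  simp only [hχ, sum_const, hv] at h1
  exact absurd h1 (by decide)

lemma finrank_space_add_finrank_relations :
    finrank (ZMod 2) C.toQuantumCode.space + finrank (ZMod 2) C.relations =
      Fintype.card Γ.Face := by
  have h := (Fintype.linearCombination (ZMod 2) C.stabilizer).finrank_range_add_finrank_ker
  rwa [Fintype.range_linearCombination, finrank_fintype_fun_eq_card] at h

lemma numLogical_add_card_face :
    C.toQuantumCode.numLogical + Fintype.card Γ.Face =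
      Fintype.card Γ.Vertex + finrank (ZMod 2) C.relations := by
  have h1 := C.finrank_space_add_finrank_relations
  have h2 := C.toQuantumCode.finrank_logicalSpace_quotient_add
  rw [QuantumCode.numLogical]
  omega

end GenonCode

/-! ### The number of logical qubits -/

theorem mainTheorem6 {D : Type*} [Fintype D] (Γ : GenonGraph D) (C : GenonCode Γ) :
    (Γ.Bicolourable → Γ.numTrivalent = 0 ∧ C.toQuantumCode.numLogical = 2 * Γ.genus) ∧
    (¬ Γ.Bicolourable →
      (C.toQuantumCode.numLogical : ℚ) = 2 * Γ.genus + (Γ.numTrivalent : ℚ) / 2 - 1) := by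
  have hk := C.numLogical_add_card_face
  have hg := Γ.two_mul_genus_add
  have hE := Γ.two_mul_card_edge
  have hV := Γ.card_add_numTrivalent
  constructor
  · intro h
    have hm := GenonCode.numTrivalent_eq_zero_of_bicolourable h
    rw [C.finrank_relations_of_bicolourable h] at hk
    exact ⟨hm, by omega⟩
  · intro h
    rw [C.finrank_relations_of_not_bicolourable h] at hk
    have h2 : 2 * C.toQuantumCode.numLogical + 2 = 4 * Γ.genus + Γ.numTrivalent := by omega
    have h3 : (2 * C.toQuantumCode.numLogical + 2 : ℚ) = 4 * Γ.genus + Γ.numTrivalent := by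
      exact_mod_cast h2
    linarith
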